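/- Theorem (Properties of dyadic cubes). \emph{Setting.} Let $A_0,A_1\ge 1$. A space of homogeneous type with constants $A_0,A_1$ is a triple $(X,\rho,\mu)$ in which $X$ is a non-empty set; $\rho:X\times X\to[0,\infty)$ is a quasi-metric, i.e. $\rho(x,y)=0$ iff $x=y$, $\rho(x,y)=\rho(y,x)$ and $\rho(x,z)\le A_0\rho(x,y)+A_0\rho(y,z)$ for all $x,y,z\in X$; all balls $B(x,r)=\{y\in X:\rho(x,y)<r\}$, $r>0$, are open in the topology induced by $\rho$ (a set is open iff it contains a ball around each of its points); and $\mu$ is a Borel regular measure on $X$ with $0<\mu(B(x,r))<\infty$ and $\mu(B(x,2r))\le A_1\,\mu(B(x,r))$ for all $x\in X$, $r>0$. Put $\mathrm{diam}(A)=\sup_{x,y\in A}\rho(x,y)$ and $\rho(x,A)=\inf_{y\in A}\rho(x,y)$, with $\rho(x,\varnothing)=\infty$. Let $\delta,a_0\in(0,1)$. For each $k\in\mathbb Z$ let $Z_k=\{z^k_\alpha:\alpha\in I_k\}\subset X$, where distinct indices label distinct points, be a maximal set whose distinct points have mutual distance $\rho\ge\delta^k$. Let $\preceq$ be a partial order on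 the set of pairs $(k,\alpha)$, $k\in\mathbb Z$, $\alpha\in I_k$, such that (i) if $(k,\alpha)\preceq(l,\beta)$, then $k\ge l$; (ii) for each $(k,\alpha)$ and $l\le k$ there is a unique $\beta\in I_l$ with $(k,\alpha)\preceq(l,\beta)$; (iii) if $(k,\alpha)\preceq(k-1,\beta)$, then $\rho(z^k_\alpha,z^{k-1}_\beta)<\delta^{k-1}$; (iv) if $\rho(z^k_\alpha,z^{k-1}_\beta)<\frac1{2A_0}\delta^{k-1}$, then $(k,\alpha)\preceq(k-1,\beta)$. Define the dyadic cubes $$Q^k_\alpha=\bigcup_{(l,\beta)\preceq(k,\alpha)}B(z^l_\beta,a_0\delta^l),\qquad \mathcal D_k=\{Q^k_\alpha:\alpha\in I_k\}.$$ \emph{Claim.} For all $A_0,A_1\ge1$ there exist constants $\delta\in(0,1)$, $a_0\in(0,1)$, $\eta>0$, $C_1,C_2\in(0,\infty)$ and $N_0\in\mathbb N$, depending only on $A_0$ and $A_1$, such that for every space of homogeneous type $(X,\rho,\mu)$ with constants $A_0,A_1$, every choice of the maximal sets $Z_k$ and every partial order $\preceq$ as above, the following hold. (a) Each $Q^k_\alpha$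 is open. (b) Each $Q^k_\alpha$ contains the ball $B(z^k_\alpha,a_0\delta^k)$. (c) $\mathrm{diam}(Q^k_\alpha)\le C_1\delta^k$ for each $Q^k_\alpha$. (d) For each $Q^k_\alpha$ and each $l<k$ there exists a unique $\beta\in I_l$ such that $Q^k_\alpha\subset Q^l_\beta$. (e) If $l\ge k$, $\alpha\in I_k$ and $\beta\in I_l$, then exactly one of $Q^l_\beta\subset Q^k_\alpha$ and $Q^l_\beta\cap Q^k_\alpha=\varnothing$ holds. (f) For each $Q^k_\alpha$, $\#\{Q\in\mathcal D_{k+1}:Q\subset Q^k_\alpha\}\le N_0$. (g) For each $k\in\mathbb Z$, $\mu\bigl(X\setminus\bigcup_{\alpha\in I_k}Q^k_\alpha\bigr)=0$. (h) For each $Q^k_\alpha$ and each $t>0$, $$\mu\bigl(\{x\in Q^k_\alpha:\rho(x,X\setminus\overline{Q^k_\alpha})\le t\delta^k\}\bigr)\le C_2t^\eta\mu(Q^k_\alpha),$$ where $\overline{Q^k_\alpha}$ is the closure of $Q^k_\alpha$. -/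

import Mathlib

open scoped ENNReal

/-- `ρ` is a quasi-metric on `X` with quasi-triangle constant `A₀`. -/
structure IsQuasiMetric {X : Type*} (ρ : X → X → ℝ) (A₀ : ℝ) : Prop where
  nonneg : ∀ x y, 0 ≤ ρ x y
  eq_zero_iff : ∀ x y, ρ x y = 0 ↔ x = y
  symm : ∀ x y, ρ x y = ρ y x
  triangle : ∀ x y z, ρ x z ≤ A₀ * ρ x y + A₀ * ρ y z

/-- The ball `B(x, r)` of a quasi-metric. -/
def quasiBall {X : Type*} (ρ : X → X → ℝ) (x : X) (r : ℝ) : Set X :=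
  {y | ρ x y < r}

/-- The diameter of a set, with values in `[0, ∞]`. -/
noncomputable def quasiDiam {X : Type*} (ρ : X → X → ℝ) (A : Set X) : ℝ≥0∞ :=
  ⨆ x ∈ A, ⨆ y ∈ A, ENNReal.ofReal (ρ x y)

/-- The distance from a point to a set, with values in `[0, ∞]`; the distance to `∅` is `∞`. -/
noncomputable def quasiInfDist {X : Type*} (ρ : X → X → ℝ) (x : X) (A : Set X) : ℝ≥0∞ :=
  ⨅ y ∈ A, ENNReal.ofReal (ρ x y)

/-- `(X, ρ, μ)` is a space of homogeneous type with quasi-triangle constant `A₀` and doubling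
constant `A₁`. The topology of `X` is the one induced by `ρ` (field `isOpen_iff`), balls are open,
and `μ` is a doubling Borel measure. As Mathlib evaluates a measure on an arbitrary set by the
infimum over its measurable supersets, a measure on the Borel sets is the same thing as a
Borel regular (outer) measure. -/
structure IsHomogeneousType {X : Type*} [TopologicalSpace X] [MeasurableSpace X] [BorelSpace X]
    (ρ : X → X → ℝ) (μ : MeasureTheory.Measure X) (A₀ A₁ : ℝ) : Prop where
  nonempty : Nonempty X
  isQuasiMetric : IsQuasiMetric ρ A₀
  isOpen_iff : ∀ U : Set X, IsOpen U ↔ ∀ x ∈ U, ∃ r > 0, quasiBall ρ x r ⊆ U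
  isOpen_ball : ∀ (x : X) (r : ℝ), 0 < r → IsOpen (quasiBall ρ x r)
  measure_ball_pos : ∀ (x : X) (r : ℝ), 0 < r → 0 < μ (quasiBall ρ x r)
  measure_ball_lt_top : ∀ (x : X) (r : ℝ), 0 < r → μ (quasiBall ρ x r) < ∞
  doubling : ∀ (x : X) (r : ℝ), 0 < r →
    μ (quasiBall ρ x (2 * r)) ≤ ENNReal.ofReal A₁ * μ (quasiBall ρ x r)

/-- `Z` is a maximal `r`-separated set: `ρ x y ≥ r` for distinct points `x`, `y` of `Z`, and no
strictly larger set has this property. -/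
def IsMaximalSeparated {X : Type*} (ρ : X → X → ℝ) (r : ℝ) (Z : Set X) : Prop :=
  Maximal (fun S : Set X => S.Pairwise fun x y => r ≤ ρ x y) Z

/-- The index pairs `(k, α)`; the points of `Z k` are labelled by themselves, so that
`I_k = Z k` and `z^k_α = α`. -/
abbrev IndexPair {X : Type*} (Z : ℤ → Set X) : Type _ :=
  Σ k : ℤ, Z k

/-- `le` is a partial order on the index pairs that makes them a tree compatible with the
generations and with the positions of the reference points; `le (k, α) (l, β)` says that
`(l, β)` is an ancestor of `(k, α)`. -/
structure IsTreeOrder {X : Type*} (ρ : X → X → ℝ) (A₀ δ : ℝ) (Z : ℤ → Set X)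
    (le : IndexPair Z → IndexPair Z → Prop) : Prop where
  refl : ∀ p, le p p
  antisymm : ∀ p q, le p q → le q p → p = q
  trans : ∀ p q s, le p q → le q s → le p s
  generation : ∀ p q, le p q → q.1 ≤ p.1
  ancestor : ∀ (k : ℤ) (α : Z k) (l : ℤ), l ≤ k → ∃! β : Z l, le ⟨k, α⟩ ⟨l, β⟩
  dist_lt : ∀ (k : ℤ) (α : Z k) (β : Z (k - 1)),
    le ⟨k, α⟩ ⟨k - 1, β⟩ → ρ α β < δ ^ (k - 1)
  le_of_dist_lt : ∀ (k : ℤ) (α : Z k) (β : Z (k - 1)),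
    ρ α β < 1 / (2 * A₀) * δ ^ (k - 1) → le ⟨k, α⟩ ⟨k - 1, β⟩

/-- The dyadic cube `Q^k_α`, the union of the balls `B(z^l_β, a₀ δ^l)` over all
`(l, β) ≼ (k, α)`. -/
def dyadicCube {X : Type*} (ρ : X → X → ℝ) (δ a₀ : ℝ) {Z : ℤ → Set X}
    (le : IndexPair Z → IndexPair Z → Prop) (k : ℤ) (α : Z k) : Set X :=
  ⋃ (p : IndexPair Z) (_ : le p ⟨k, α⟩), quasiBall ρ p.2 (a₀ * δ ^ p.1)

/-- The family of all dyadic cubes of generation `k`. -/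
def dyadicFamily {X : Type*} (ρ : X → X → ℝ) (δ a₀ : ℝ) {Z : ℤ → Set X}
    (le : IndexPair Z → IndexPair Z → Prop) (k : ℤ) : Set (Set X) :=
  Set.range (dyadicCube ρ δ a₀ le k)

/-! With `a` small and `δ` much smaller, two constituent balls that meet must have tree-comparable
indices (`le_of_quasiBalls_meet`). As ancestors are unique, distinct cubes of one generation are
disjoint, and inclusion of cubes is the tree order on indices. Nesting follows; a chain of ancestors
is dominated by its top link, which bounds the diameters.

By doubling, a child carries at least a fixed fraction `1 / D` of its parent's mass; since children
are disjoint, this bounds their number. No differentiation theorem is needed for the null set: the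
missed set is covered at every small scale by net balls which, once shrunk, are disjoint, lie inside
the cubes and sit near the missed set. The shrunken balls lose all mass as the scale tends to zero,
and doubling passes this on to the missed set.

For the boundary layer, each cube has a central child far from its complement. A thin layer avoids
that child and, up to a null set, lies in the layers of the other children. Each generation thus
costs a factor `q < 1`, and iterating down to the scale of the layer gives a power of `t`. -/

open Set Filter Topology MeasureTheory

/-! ### Balls and separated sets in a quasi-metric -/

section QuasiMetric

variable {X : Type*} {ρ : X → X → ℝ} {A : ℝ}

theorem IsQuasiMetric.self_eq_zero (h : IsQuasiMetric ρ A) (x : X) : ρ x x = 0 :=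
  (h.eq_zero_iff x x).2 rfl

theorem IsQuasiMetric.quasiBall_subset (h : IsQuasiMetric ρ A) (hA : 1 ≤ A) {x y : X} {d r R : ℝ}
    (hd : ρ x y ≤ d) (hR : A * d + A * r ≤ R) : quasiBall ρ y r ⊆ quasiBall ρ x R := by
  intro z (hz : ρ y z < r)
  have h1 := h.triangle x y z
  have h2 : A * ρ x y ≤ A * d := mul_le_mul_of_nonneg_left hd (by linarith)
  have h3 : A * ρ y z < A * r := mul_lt_mul_of_pos_left hz (by linarith)
  show ρ x z < R
  linarith

theorem IsMaximalSeparated.exists_lt (h : IsQuasiMetric ρ A) {r : ℝ} (hr : 0 < r) {Z : Set X}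
    (hZ : IsMaximalSeparated ρ r Z) (x : X) : ∃ z : Z, ρ x z < r := by
  by_contra! hc
  have hs : (insert x Z).Pairwise fun x y => r ≤ ρ x y := by
    refine hZ.prop.insert fun z hz _ => ⟨hc ⟨z, hz⟩, ?_⟩
    rw [h.symm]
    exact hc ⟨z, hz⟩
  have hx : x ∈ Z := hZ.le_of_ge hs (subset_insert x Z) (mem_insert x Z)
  have := hc ⟨x, hx⟩
  rw [h.self_eq_zero] at this
  linarith

theorem IsMaximalSeparated.eq_of_lt {r : ℝ} {Z : Set X} (hZ : IsMaximalSeparated ρ r Z)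
    {x y : Z} (hxy : ρ x y < r) : x = y := by
  by_contra hne
  exact (hZ.prop x.2 y.2 fun e => hne (Subtype.ext e)).not_gt hxy

theorem iUnion_quasiBall_nat (x : X) : ⋃ n : ℕ, quasiBall ρ x (n + 1) = univ :=
  eq_univ_of_forall fun y => by
    obtain ⟨n, hn⟩ := exists_nat_gt (ρ x y)
    exact mem_iUnion.2 ⟨n, show ρ x y < n + 1 by linarith⟩

theorem measure_eq_zero_of_inter_quasiBall [MeasurableSpace X] {μ : Measure X}
    {s : Set X} (x : X) (hs : ∀ R > 0, μ (s ∩ quasiBall ρ x R) = 0) : μ s = 0 := by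
  rw [← inter_univ s, ← iUnion_quasiBall_nat (ρ := ρ) x, inter_iUnion]
  exact measure_iUnion_null fun n => hs _ (by positivity)

end QuasiMetric

/-- The smallness conditions on the parameters `δ` and `a` of the dyadic cubes. -/
structure IsAdmissible (A δ a : ℝ) : Prop where
  one_le : 1 ≤ A
  δ_pos : 0 < δ
  a_pos : 0 < a
  a_le : 8 * A ^ 3 * a ≤ 1
  δ_le : 8 * A ^ 4 * δ ≤ a

namespace IsAdmissible

variable {A δ a : ℝ}

theorem A_a_le (h : IsAdmissible A δ a) : 8 * A * a ≤ 1 := by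
  have h1 : A ≤ A ^ 3 := le_self_pow₀ h.one_le (by norm_num)
  have := mul_le_mul_of_nonneg_right h1 h.a_pos.le
  have := h.a_le
  linarith

theorem a_le_eighth (h : IsAdmissible A δ a) : 8 * a ≤ 1 := by
  have := mul_le_mul_of_nonneg_right h.one_le h.a_pos.le
  have := h.A_a_le
  linarith

theorem pow_mul_δ_le (h : IsAdmissible A δ a) {n : ℕ} (hn : n ≤ 4) : 8 * A ^ n * δ ≤ a := by
  have h1 : A ^ n ≤ A ^ 4 := pow_le_pow_right₀ h.one_le hn
  have := mul_le_mul_of_nonneg_right h1 h.δ_pos.le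
  have := h.δ_le
  linarith

theorem δ_lt_one (h : IsAdmissible A δ a) : δ < 1 := by
  have := h.pow_mul_δ_le (n := 0) (by norm_num)
  have := h.a_le_eighth
  have := h.δ_pos
  simp at *
  linarith

theorem A_δ_le (h : IsAdmissible A δ a) : 8 * A * δ ≤ a := by
  simpa using h.pow_mul_δ_le (n := 1) (by norm_num)

theorem zpow_pos (h : IsAdmissible A δ a) (k : ℤ) : 0 < δ ^ k := _root_.zpow_pos h.δ_pos k

theorem zpow_le (h : IsAdmissible A δ a) {k l : ℤ} (hkl : k ≤ l) : δ ^ l ≤ δ ^ k :=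
  zpow_le_zpow_right_of_le_one₀ h.δ_pos h.δ_lt_one.le hkl

theorem zpow_succ (h : IsAdmissible A δ a) (k : ℤ) : δ ^ (k + 1) = δ ^ k * δ :=
  zpow_add_one₀ h.δ_pos.ne' k

end IsAdmissible

/-! ### Geometry and nesting of the cubes -/

section Tree

variable {X : Type*} {ρ : X → X → ℝ} {A δ a : ℝ} {Z : ℤ → Set X}
  {le : IndexPair Z → IndexPair Z → Prop}

namespace IsTreeOrder

theorem eq_of_le (hle : IsTreeOrder ρ A δ Z le) {k l : ℤ} {α : Z k} {β γ : Z l}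
    (h₁ : le ⟨k, α⟩ ⟨l, β⟩) (h₂ : le ⟨k, α⟩ ⟨l, γ⟩) : β = γ :=
  (hle.ancestor k α l (hle.generation _ _ h₁)).unique h₁ h₂

theorem dist_succ_lt (hle : IsTreeOrder ρ A δ Z le) {k l : ℤ} (hl : l = k + 1) {α : Z k} {β : Z l}
    (h : le ⟨l, β⟩ ⟨k, α⟩) : ρ β α < δ ^ k := by
  obtain rfl : k = l - 1 := by lia
  exact hle.dist_lt _ _ _ h

theorem le_succ_of_dist_lt (hle : IsTreeOrder ρ A δ Z le) {k l : ℤ} (hl : l = k + 1) {α : Z k}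
    {β : Z l} (h : ρ β α < 1 / (2 * A) * δ ^ k) : le ⟨l, β⟩ ⟨k, α⟩ := by
  obtain rfl : k = l - 1 := by lia
  exact hle.le_of_dist_lt _ _ _ h

theorem exists_le (hle : IsTreeOrder ρ A δ Z le) {k l : ℤ} (hkl : k ≤ l) (β : Z l) :
    ∃ α : Z k, le ⟨l, β⟩ ⟨k, α⟩ :=
  (hle.ancestor l β k hkl).exists

/-- An index lies below every intermediate ancestor of a descendant that it dominates. -/
theorem le_of_le_of_le (hle : IsTreeOrder ρ A δ Z le) {k l m : ℤ} {α : Z k} {β : Z l} {γ : Z m}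
    (hkm : k ≤ m) (h₁ : le ⟨l, β⟩ ⟨m, γ⟩) (h₂ : le ⟨l, β⟩ ⟨k, α⟩) : le ⟨m, γ⟩ ⟨k, α⟩ := by
  obtain ⟨α', h⟩ := hle.exists_le hkm γ
  rwa [hle.eq_of_le h₂ (hle.trans _ _ _ h₁ h)]

/-- Splitting the chain at its top link puts the accumulated factor `A` on the smaller scale `δ ^ (k
+ 1)`, where `2 * A * δ ≤ 1` absorbs it; splitting at the bottom would let powers of `A` build up.
-/
theorem dist_lt_of_le (hle : IsTreeOrder ρ A δ Z le) (hρ : IsQuasiMetric ρ A)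
    (h : IsAdmissible A δ a) (n : ℕ) : ∀ {k l : ℤ} {α : Z k} {β : Z l}, l = k + n →
    le ⟨l, β⟩ ⟨k, α⟩ → ρ β α < 2 * A * δ ^ k := by
  have hA := h.one_le
  induction n with
  | zero =>
    intro k l α β hl hβα
    obtain rfl : l = k := by simpa using hl
    rw [hle.eq_of_le hβα (hle.refl _), hρ.self_eq_zero]
    have := h.zpow_pos l
    positivity
  | succ n ih =>
    intro k l α β hl hβα
    push_cast at hl
    obtain ⟨γ, hγ⟩ := hle.exists_le (show k + 1 ≤ l by lia) β
    have h1 := ih (by lia) hγ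
    have h2 := hle.dist_succ_lt rfl (hle.le_of_le_of_le (by lia) hγ hβα)
    have h3 := hρ.triangle β γ α
    have hp := h.zpow_pos k
    rw [h.zpow_succ] at h1
    have h4 : A * ρ β γ ≤ A * (2 * A * (δ ^ k * δ)) :=
      mul_le_mul_of_nonneg_left h1.le (by linarith)
    have h5 : A * ρ γ α < A * δ ^ k := mul_lt_mul_of_pos_left h2 (by linarith)
    have h6 : 2 * A * δ ≤ 1 := by
      have := h.A_δ_le
      have := h.a_le_eighth
      have := h.a_pos
      linarith
    have h7 : (2 * A * δ) * (A * δ ^ k) ≤ 1 * (A * δ ^ k) :=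
      mul_le_mul_of_nonneg_right h6 (by positivity)
    linarith

end IsTreeOrder

theorem quasiBall_subset_dyadicCube {k l : ℤ} {α : Z k} {β : Z l} (h : le ⟨l, β⟩ ⟨k, α⟩) :
    quasiBall ρ β (a * δ ^ l) ⊆ dyadicCube ρ δ a le k α :=
  subset_iUnion₂_of_subset (⟨l, β⟩ : IndexPair Z) h subset_rfl

theorem dyadicCube_subset (hle : IsTreeOrder ρ A δ Z le) {k l : ℤ} {α : Z k} {β : Z l}
    (h : le ⟨l, β⟩ ⟨k, α⟩) : dyadicCube ρ δ a le l β ⊆ dyadicCube ρ δ a le k α :=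
  iUnion₂_subset fun p hp => subset_iUnion₂_of_subset p (hle.trans _ _ _ hp h) subset_rfl

theorem mem_dyadicCube {k : ℤ} {α : Z k} {x : X} :
    x ∈ dyadicCube ρ δ a le k α ↔
      ∃ (l : ℤ) (β : Z l), le ⟨l, β⟩ ⟨k, α⟩ ∧ ρ β x < a * δ ^ l := by
  simp [dyadicCube, quasiBall, Sigma.exists]

theorem center_mem_dyadicCube (hle : IsTreeOrder ρ A δ Z le) (hρ : IsQuasiMetric ρ A)
    (h : IsAdmissible A δ a) {k : ℤ} (α : Z k) : (α : X) ∈ dyadicCube ρ δ a le k α :=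
  mem_dyadicCube.2 ⟨k, α, hle.refl _, by
    rw [hρ.self_eq_zero]
    exact mul_pos h.a_pos (h.zpow_pos k)⟩

theorem dyadicCube_subset_quasiBall (hle : IsTreeOrder ρ A δ Z le) (hρ : IsQuasiMetric ρ A)
    (h : IsAdmissible A δ a) {k : ℤ} (α : Z k) :
    dyadicCube ρ δ a le k α ⊆ quasiBall ρ α (3 * A ^ 2 * δ ^ k) := by
  intro x hx
  obtain ⟨l, β, hβα, hx⟩ := mem_dyadicCube.1 hx
  have hkl : k ≤ l := hle.generation _ _ hβα
  have h1 := hle.dist_lt_of_le hρ h (l - k).toNat (by lia) hβα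
  rw [hρ.symm] at h1
  refine hρ.quasiBall_subset h.one_le h1.le ?_ hx
  have h2 := h.A_a_le
  have h3 : 1 ≤ A ^ 2 := one_le_pow₀ h.one_le
  have h4 : A * a * δ ^ l ≤ A ^ 2 * δ ^ k := by
    have := h.zpow_pos k
    have := h.zpow_pos l
    exact mul_le_mul (by linarith) (h.zpow_le hkl) this.le (by positivity)
  linarith

/-- If two of the balls that make up cubes meet, then the smaller one descends from the larger. -/
theorem le_of_quasiBalls_meet (hle : IsTreeOrder ρ A δ Z le) (hρ : IsQuasiMetric ρ A)
    (h : IsAdmissible A δ a) (hZ : ∀ k, IsMaximalSeparated ρ (δ ^ k) (Z k)) {m n : ℤ} (hmn : m ≤ n)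
    {γ : Z m} {σ : Z n} {x : X} (hγ : ρ γ x < a * δ ^ m) (hσ : ρ σ x < a * δ ^ n) :
    le ⟨n, σ⟩ ⟨m, γ⟩ := by
  have hA := h.one_le
  have hp := h.zpow_pos m
  have ha := h.a_pos
  have h1 : ρ σ γ < 2 * A * a * δ ^ m := by
    have h2 := hρ.triangle σ x γ
    rw [hρ.symm x γ] at h2
    have h3 : A * ρ σ x < A * (a * δ ^ n) := mul_lt_mul_of_pos_left hσ (by linarith)
    have h4 : A * ρ γ x < A * (a * δ ^ m) := mul_lt_mul_of_pos_left hγ (by linarith)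
    have h5 : A * (a * δ ^ n) ≤ A * (a * δ ^ m) := by
      have := h.zpow_le hmn
      gcongr
    linarith
  rcases hmn.eq_or_lt with rfl | hlt
  · have : σ = γ := by
      refine (hZ m).eq_of_lt (h1.trans_le ?_)
      have := h.A_a_le
      have : 2 * A * a * δ ^ m ≤ 1 * δ ^ m := mul_le_mul_of_nonneg_right (by linarith) hp.le
      linarith
    rw [this]
    exact hle.refl _
  -- The ancestor of `σ` just below generation `m` is close enough to `γ` for the proximity axiom to
  -- make it a child of `γ`.
  · obtain ⟨τ, hτ⟩ := hle.exists_le (show m + 1 ≤ n by lia) σ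
    refine hle.trans _ _ _ hτ (hle.le_succ_of_dist_lt rfl ?_)
    have h2 := hle.dist_lt_of_le hρ h (n - (m + 1)).toNat (by lia) hτ
    have h3 := hρ.triangle τ σ γ
    rw [hρ.symm τ σ] at h3
    have h4 : A * ρ σ τ < A * (2 * A * δ ^ (m + 1)) := mul_lt_mul_of_pos_left h2 (by linarith)
    have h5 : A * ρ σ γ < A * (2 * A * a * δ ^ m) := mul_lt_mul_of_pos_left h1 (by linarith)
    rw [h.zpow_succ] at h4
    have h6 : A * (2 * A * a) + A * (2 * A * δ) ≤ 1 / (2 * A) := by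
      rw [le_div_iff₀ (by linarith)]
      have h7 := h.a_le
      have h8 := h.pow_mul_δ_le (n := 3) (by norm_num)
      have h9 := h.a_le_eighth
      linarith
    have := mul_le_mul_of_nonneg_right h6 hp.le
    linarith

/-- The finer of the two balls through `x` descends from the coarser, so it has both `α` and `β` as
ancestors in generation `k`. -/
theorem eq_of_dyadicCubes_meet (hle : IsTreeOrder ρ A δ Z le) (hρ : IsQuasiMetric ρ A)
    (h : IsAdmissible A δ a) (hZ : ∀ k, IsMaximalSeparated ρ (δ ^ k) (Z k)) {k : ℤ}
    {α β : Z k} {x : X} (hα : x ∈ dyadicCube ρ δ a le k α) (hβ : x ∈ dyadicCube ρ δ a le k β) :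
    α = β := by
  obtain ⟨m, γ, hγ, hxγ⟩ := mem_dyadicCube.1 hα
  obtain ⟨n, σ, hσ, hxσ⟩ := mem_dyadicCube.1 hβ
  rcases le_total m n with hmn | hmn
  · exact hle.eq_of_le (hle.trans _ _ _ (le_of_quasiBalls_meet hle hρ h hZ hmn hxγ hxσ) hγ) hσ
  · exact hle.eq_of_le hγ (hle.trans _ _ _ (le_of_quasiBalls_meet hle hρ h hZ hmn hxσ hxγ) hσ)

theorem pairwise_disjoint_dyadicCube (hle : IsTreeOrder ρ A δ Z le) (hρ : IsQuasiMetric ρ A)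
    (h : IsAdmissible A δ a) (hZ : ∀ k, IsMaximalSeparated ρ (δ ^ k) (Z k)) (k : ℤ) :
    Pairwise (Function.onFun Disjoint (dyadicCube ρ δ a le k)) := fun _ _ hne =>
  disjoint_left.2 fun _ hα hβ => hne (eq_of_dyadicCubes_meet hle hρ h hZ hα hβ)

theorem le_of_dyadicCubes_meet (hle : IsTreeOrder ρ A δ Z le) (hρ : IsQuasiMetric ρ A)
    (h : IsAdmissible A δ a) (hZ : ∀ k, IsMaximalSeparated ρ (δ ^ k) (Z k)) {k l : ℤ} (hkl : k ≤ l)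
    {α : Z k} {β : Z l} {x : X} (hα : x ∈ dyadicCube ρ δ a le k α)
    (hβ : x ∈ dyadicCube ρ δ a le l β) : le ⟨l, β⟩ ⟨k, α⟩ := by
  obtain ⟨γ, hγ⟩ := hle.exists_le hkl β
  rwa [eq_of_dyadicCubes_meet hle hρ h hZ hα (dyadicCube_subset hle hγ hβ)]

theorem dyadicCube_subset_iff (hle : IsTreeOrder ρ A δ Z le) (hρ : IsQuasiMetric ρ A)
    (h : IsAdmissible A δ a) (hZ : ∀ k, IsMaximalSeparated ρ (δ ^ k) (Z k)) {k l : ℤ} (hkl : k ≤ l)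
    {α : Z k} {β : Z l} :
    dyadicCube ρ δ a le l β ⊆ dyadicCube ρ δ a le k α ↔ le ⟨l, β⟩ ⟨k, α⟩ :=
  ⟨fun hs => le_of_dyadicCubes_meet hle hρ h hZ hkl (hs (center_mem_dyadicCube hle hρ h β))
    (center_mem_dyadicCube hle hρ h β), dyadicCube_subset hle⟩

theorem xor_subset_disjoint_dyadicCube (hle : IsTreeOrder ρ A δ Z le) (hρ : IsQuasiMetric ρ A)
    (h : IsAdmissible A δ a) (hZ : ∀ k, IsMaximalSeparated ρ (δ ^ k) (Z k)) {k l : ℤ} (hkl : k ≤ l)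
    (α : Z k) (β : Z l) :
    Xor (dyadicCube ρ δ a le l β ⊆ dyadicCube ρ δ a le k α)
      (dyadicCube ρ δ a le l β ∩ dyadicCube ρ δ a le k α = ∅) := by
  by_cases hβα : le ⟨l, β⟩ ⟨k, α⟩
  · refine Or.inl ⟨dyadicCube_subset hle hβα, ?_⟩
    exact Nonempty.ne_empty ⟨β, center_mem_dyadicCube hle hρ h β,
      dyadicCube_subset hle hβα (center_mem_dyadicCube hle hρ h β)⟩
  · refine Or.inr ⟨?_, fun hs => hβα ((dyadicCube_subset_iff hle hρ h hZ hkl).1 hs)⟩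
    exact eq_empty_of_forall_notMem fun x hx =>
      hβα (le_of_dyadicCubes_meet hle hρ h hZ hkl hx.2 hx.1)

theorem existsUnique_dyadicCube_subset (hle : IsTreeOrder ρ A δ Z le) (hρ : IsQuasiMetric ρ A)
    (h : IsAdmissible A δ a) (hZ : ∀ k, IsMaximalSeparated ρ (δ ^ k) (Z k)) {k l : ℤ} (hlk : l ≤ k)
    (α : Z k) : ∃! β : Z l, dyadicCube ρ δ a le k α ⊆ dyadicCube ρ δ a le l β := by
  simp only [dyadicCube_subset_iff hle hρ h hZ hlk]
  exact hle.ancestor k α l hlk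

theorem quasiDiam_dyadicCube_le (hle : IsTreeOrder ρ A δ Z le) (hρ : IsQuasiMetric ρ A)
    (h : IsAdmissible A δ a) {k : ℤ} (α : Z k) :
    quasiDiam ρ (dyadicCube ρ δ a le k α) ≤ ENNReal.ofReal (6 * A ^ 3 * δ ^ k) := by
  refine iSup₂_le fun x hx => iSup₂_le fun y hy => ENNReal.ofReal_le_ofReal ?_
  have hx' : ρ α x < 3 * A ^ 2 * δ ^ k := dyadicCube_subset_quasiBall hle hρ h α hx
  have hy' : ρ α y < 3 * A ^ 2 * δ ^ k := dyadicCube_subset_quasiBall hle hρ h α hy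
  have h1 := hρ.triangle x α y
  rw [hρ.symm x α] at h1
  have hA := h.one_le
  have h2 : A * ρ α x ≤ A * (3 * A ^ 2 * δ ^ k) := mul_le_mul_of_nonneg_left hx'.le (by linarith)
  have h3 : A * ρ α y ≤ A * (3 * A ^ 2 * δ ^ k) := mul_le_mul_of_nonneg_left hy'.le (by linarith)
  linarith

/-- Every cube has a child that lies deep inside it. -/
theorem exists_central_child (hle : IsTreeOrder ρ A δ Z le) (hρ : IsQuasiMetric ρ A)
    (h : IsAdmissible A δ a) (hZ : ∀ k, IsMaximalSeparated ρ (δ ^ k) (Z k)) {k : ℤ} (α : Z k) :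
    ∃ γ : Z (k + 1), le ⟨k + 1, γ⟩ ⟨k, α⟩ ∧ ∀ x ∈ dyadicCube ρ δ a le (k + 1) γ,
      ∀ y, ρ x y < a / (2 * A) * δ ^ k → y ∈ dyadicCube ρ δ a le k α := by
  have hA := h.one_le
  have hp := h.zpow_pos k
  obtain ⟨γ, hγ⟩ := (hZ (k + 1)).exists_lt hρ (h.zpow_pos (k + 1)) α
  refine ⟨γ, hle.le_succ_of_dist_lt rfl ?_, fun x hx y hxy => ?_⟩
  · rw [hρ.symm]
    refine hγ.trans_le ?_
    rw [h.zpow_succ, mul_comm]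
    refine mul_le_mul_of_nonneg_right ?_ hp.le
    rw [le_div_iff₀ (by linarith)]
    have := h.A_δ_le
    have := h.a_le_eighth
    have := h.a_pos
    linarith
  · have hx' := hρ.quasiBall_subset hA hγ.le (le_refl _) (dyadicCube_subset_quasiBall hle hρ h γ hx)
    have hx₂ : ρ α x < A * δ ^ (k + 1) + A * (3 * A ^ 2 * δ ^ (k + 1)) := hx'
    rw [h.zpow_succ] at hx₂
    refine quasiBall_subset_dyadicCube (hle.refl _) ?_
    show ρ α y < a * δ ^ k
    have h1 := hρ.triangle α x y
    have h2 : A * ρ α x ≤ A * (A * (δ ^ k * δ) + A * (3 * A ^ 2 * (δ ^ k * δ))) :=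
      mul_le_mul_of_nonneg_left hx₂.le (by linarith)
    have h3 : A * ρ x y < A * (a / (2 * A) * δ ^ k) := mul_lt_mul_of_pos_left hxy (by linarith)
    have h4 : A * (a / (2 * A) * δ ^ k) = a / 2 * δ ^ k := by field_simp
    -- The child's cube uses up half of the radius `a * δ ^ k`, the step from `x` to `y` the other
    -- half. This fixes the power `A ^ 4` in `δ_le`.
    have h5 : A ^ 2 * δ + 3 * A ^ 4 * δ ≤ a / 2 := by
      have := h.pow_mul_δ_le (n := 2) (by norm_num)
      have := h.δ_le
      linarith
    have := mul_le_mul_of_nonneg_right h5 hp.le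
    linarith

end Tree

/-! ### Doubling, null sets and boundary layers -/

section Measure

variable {X : Type*} [TopologicalSpace X] [MeasurableSpace X] [BorelSpace X] {ρ : X → X → ℝ}
  {μ : Measure X} {A A₁ : ℝ}

namespace IsHomogeneousType

theorem measure_quasiBall_two_pow_mul_le (hX : IsHomogeneousType ρ μ A A₁) (n : ℕ) (x : X)
    {r : ℝ} (hr : 0 < r) :
    μ (quasiBall ρ x (2 ^ n * r)) ≤ ENNReal.ofReal A₁ ^ n * μ (quasiBall ρ x r) := by
  induction n with
  | zero => simp
  | succ n ih =>
    rw [pow_succ', pow_succ', mul_assoc, mul_assoc]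
    exact (hX.doubling x _ (by positivity)).trans (mul_le_mul_right ih _)

theorem measure_quasiBall_le (hX : IsHomogeneousType ρ μ A A₁) {n : ℕ} (x : X) {r R : ℝ}
    (hr : 0 < r) (hR : R ≤ 2 ^ n * r) :
    μ (quasiBall ρ x R) ≤ ENNReal.ofReal A₁ ^ n * μ (quasiBall ρ x r) :=
  (measure_mono fun _ hy => lt_of_lt_of_le hy hR).trans
    (hX.measure_quasiBall_two_pow_mul_le n x hr)

theorem sigmaFinite (hX : IsHomogeneousType ρ μ A A₁) : SigmaFinite μ := by
  obtain ⟨x⟩ := hX.nonempty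
  exact ⟨⟨{ set := fun n : ℕ => quasiBall ρ x (n + 1)
            set_mem := fun _ => mem_univ _
            finite := fun n => hX.measure_ball_lt_top x _ (by positivity)
            spanning := iUnion_quasiBall_nat x }⟩⟩

variable {δ a : ℝ} {Z : ℤ → Set X} {le : IndexPair Z → IndexPair Z → Prop}

theorem isOpen_dyadicCube (hX : IsHomogeneousType ρ μ A A₁) (h : IsAdmissible A δ a) {k : ℤ}
    (α : Z k) : IsOpen (dyadicCube ρ δ a le k α) :=
  isOpen_iUnion fun p => isOpen_iUnion fun _ =>
    hX.isOpen_ball _ _ (mul_pos h.a_pos (h.zpow_pos p.1))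

theorem measurableSet_dyadicCube (hX : IsHomogeneousType ρ μ A A₁) (h : IsAdmissible A δ a) {k : ℤ}
    (α : Z k) : MeasurableSet (dyadicCube ρ δ a le k α) :=
  (hX.isOpen_dyadicCube h α).measurableSet

theorem measure_dyadicCube_pos (hX : IsHomogeneousType ρ μ A A₁) (h : IsAdmissible A δ a)
    (hle : IsTreeOrder ρ A δ Z le) {k : ℤ} (α : Z k) : 0 < μ (dyadicCube ρ δ a le k α) :=
  (hX.measure_ball_pos α _ (mul_pos h.a_pos (h.zpow_pos k))).trans_le
    (measure_mono (quasiBall_subset_dyadicCube (hle.refl _)))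

theorem measure_dyadicCube_lt_top (hX : IsHomogeneousType ρ μ A A₁) (h : IsAdmissible A δ a)
    (hle : IsTreeOrder ρ A δ Z le) {k : ℤ} (α : Z k) : μ (dyadicCube ρ δ a le k α) < ∞ := by
  have := h.one_le
  have := h.zpow_pos k
  exact (measure_mono (dyadicCube_subset_quasiBall hle hX.isQuasiMetric h α)).trans_lt
    (hX.measure_ball_lt_top _ _ (by positivity))

theorem countable_index (hX : IsHomogeneousType ρ μ A A₁) (h : IsAdmissible A δ a)
    (hle : IsTreeOrder ρ A δ Z le) (hZ : ∀ k, IsMaximalSeparated ρ (δ ^ k) (Z k)) (k : ℤ) :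
    Countable (Z k) := by
  have := hX.sigmaFinite
  have hc := Measure.countable_meas_pos_of_disjoint_iUnion (μ := μ)
    (fun α : Z k => hX.measurableSet_dyadicCube h (le := le) α)
    (pairwise_disjoint_dyadicCube hle hX.isQuasiMetric h hZ k)
  rw [← countable_univ_iff]
  exact hc.mono fun α _ => hX.measure_dyadicCube_pos h hle α

/-- The parent lies in a ball about the child's centre, and `n` halvings bring its radius down to
that of a ball inside the child. -/
theorem measure_dyadicCube_le_child (hX : IsHomogeneousType ρ μ A A₁) (h : IsAdmissible A δ a)
    (hle : IsTreeOrder ρ A δ Z le) {n : ℕ} (hn : 4 * A ^ 3 ≤ 2 ^ n * (a * δ)) {k : ℤ} {α : Z k}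
    {γ : Z (k + 1)} (hγ : le ⟨k + 1, γ⟩ ⟨k, α⟩) :
    μ (dyadicCube ρ δ a le k α) ≤
      ENNReal.ofReal A₁ ^ n * μ (dyadicCube ρ δ a le (k + 1) γ) := by
  have hA := h.one_le
  have hp := h.zpow_pos k
  have hρ := hX.isQuasiMetric
  calc μ (dyadicCube ρ δ a le k α)
      ≤ μ (quasiBall ρ γ (4 * A ^ 3 * δ ^ k)) := by
        refine measure_mono ((dyadicCube_subset_quasiBall hle hρ h α).trans
          (hρ.quasiBall_subset hA (hle.dist_succ_lt rfl hγ).le ?_))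
        have : A ≤ A ^ 3 := le_self_pow₀ hA (by norm_num)
        have := mul_le_mul_of_nonneg_right this hp.le
        linarith
    _ ≤ ENNReal.ofReal A₁ ^ n * μ (quasiBall ρ γ (a * δ ^ (k + 1))) := by
        refine hX.measure_quasiBall_le _ (mul_pos h.a_pos (h.zpow_pos _)) ?_
        rw [h.zpow_succ]
        have := mul_le_mul_of_nonneg_right hn hp.le
        linarith
    _ ≤ _ := by
        gcongr
        exact quasiBall_subset_dyadicCube (hle.refl _)

theorem encard_children_le (hX : IsHomogeneousType ρ μ A A₁) (h : IsAdmissible A δ a)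
    (hle : IsTreeOrder ρ A δ Z le) (hZ : ∀ k, IsMaximalSeparated ρ (δ ^ k) (Z k)) {n N : ℕ}
    (hn : 4 * A ^ 3 ≤ 2 ^ n * (a * δ)) (hN : ENNReal.ofReal A₁ ^ n ≤ N) {k : ℤ} (α : Z k) :
    {γ : Z (k + 1) | le ⟨k + 1, γ⟩ ⟨k, α⟩}.encard ≤ N := by
  have hρ := hX.isQuasiMetric
  by_contra! hlt
  obtain ⟨t, hts, ht⟩ := exists_subset_encard_eq (Order.add_one_le_of_lt hlt)
  have hfin : t.Finite := finite_of_encard_eq_coe (k := N + 1) (by simpa using ht)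
  lift t to Finset (Z (k + 1)) using hfin
  have hcard : t.card = N + 1 := by
    rw [encard_coe_eq_coe_finsetCard] at ht
    exact_mod_cast ht
  set M := μ (dyadicCube ρ δ a le k α) with hM
  have hM0 : M ≠ 0 := (hX.measure_dyadicCube_pos h hle α).ne'
  have hMt : M ≠ ∞ := (hX.measure_dyadicCube_lt_top h hle α).ne
  have h1 : (N + 1 : ℕ) * M ≤ N * M :=
    calc (N + 1 : ℕ) * M = ∑ γ ∈ t, M := by simp [hcard]
      _ ≤ ∑ γ ∈ t, ENNReal.ofReal A₁ ^ n * μ (dyadicCube ρ δ a le (k + 1) γ) :=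
        Finset.sum_le_sum fun γ hγ => hX.measure_dyadicCube_le_child h hle hn (hts hγ)
      _ = ENNReal.ofReal A₁ ^ n * μ (⋃ γ ∈ t, dyadicCube ρ δ a le (k + 1) γ) := by
        rw [← Finset.mul_sum, measure_biUnion_finset
          ((pairwise_disjoint_dyadicCube hle hρ h hZ (k + 1)).set_pairwise _)
          fun γ _ => hX.measurableSet_dyadicCube h γ]
      _ ≤ N * M := by
        gcongr
        exact measure_mono (iUnion₂_subset fun γ hγ => dyadicCube_subset hle (hts hγ))
  rw [ENNReal.mul_le_mul_iff_left hM0 hMt] at h1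
  exact absurd (Nat.cast_le.1 h1) (by lia)

/-- The points that the cubes of a given generation miss form a null set. -/
theorem measure_compl_iUnion_dyadicCube (hX : IsHomogeneousType ρ μ A A₁) (h : IsAdmissible A δ a)
    (hle : IsTreeOrder ρ A δ Z le) (hZ : ∀ k, IsMaximalSeparated ρ (δ ^ k) (Z k)) (k : ℤ) :
    μ (⋃ α : Z k, dyadicCube ρ δ a le k α)ᶜ = 0 := by
  have hρ := hX.isQuasiMetric
  have hA := h.one_le
  have ha := h.a_pos
  set E : Set X := ⋃ α : Z k, dyadicCube ρ δ a le k α with hE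
  have hEo : IsOpen E := isOpen_iUnion fun α => hX.isOpen_dyadicCube h α
  obtain ⟨x₀⟩ := hX.nonempty
  refine measure_eq_zero_of_inter_quasiBall (ρ := ρ) x₀ fun R hR => ?_
  obtain ⟨n, hn⟩ := pow_unbounded_of_one_lt (1 / a) (one_lt_two (α := ℝ))
  set D := ENNReal.ofReal A₁ ^ n with hD
  have hDt : D ≠ ∞ := ENNReal.pow_ne_top ENNReal.ofReal_ne_top
  -- Large enough to contain, for every `m`, the balls of radius `2 * A * δ ^ (k + m)` about points
  -- of `quasiBall ρ x₀ R`.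
  set R' := A * R + A * (2 * A * δ ^ k) with hR'
  have hR'0 : 0 < R' := by have := h.zpow_pos k; positivity
  -- The bounded part of `E` near `Eᶜ`. It shrinks to the empty set because `E` is open.
  let V : ℕ → Set X := fun m =>
    (⋃ x ∈ Eᶜ, quasiBall ρ x (2 * A * δ ^ (k + m))) ∩ (E ∩ quasiBall ρ x₀ R')
  have hVm : ∀ m, MeasurableSet (V m) := fun m => by
    have := h.zpow_pos (k + m)
    exact ((isOpen_biUnion fun x _ => hX.isOpen_ball x _ (by positivity)).inter
      (hEo.inter (hX.isOpen_ball x₀ _ hR'0))).measurableSet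
  have hVanti : Antitone V := fun m m' hm => by
    refine inter_subset_inter_left _ (iUnion₂_mono fun x _ y (hy : ρ x y < _) =>
      (lt_of_lt_of_le hy ?_ : ρ x y < _))
    have := h.zpow_le (show k + m ≤ k + m' by lia)
    gcongr
  have hVempty : ⋂ m, V m = ∅ := by
    refine eq_empty_of_forall_notMem fun y hy => ?_
    rw [mem_iInter] at hy
    obtain ⟨r, hr, hrE⟩ := (hX.isOpen_iff E).1 hEo y (hy 0).2.1
    have hc : 0 < 2 * A * δ ^ k := by have := h.zpow_pos k; positivity
    obtain ⟨m, hm⟩ := exists_pow_lt_of_lt_one (div_pos hr hc) h.δ_lt_one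
    obtain ⟨x, hx, hxy⟩ := mem_iUnion₂.1 (hy m).1
    refine hx (hrE ?_)
    show ρ y x < r
    rw [hρ.symm]
    refine lt_trans hxy ?_
    rw [zpow_add₀ h.δ_pos.ne', zpow_natCast, ← mul_assoc, mul_comm]
    exact (lt_div_iff₀ hc).1 hm
  have hlim : Tendsto (fun m => D * μ (V m)) atTop (𝓝 0) := by
    have := tendsto_measure_iInter_atTop (μ := μ) (fun m => (hVm m).nullMeasurableSet) hVanti
      ⟨0, ((measure_mono (inter_subset_right.trans inter_subset_right)).trans_lt
        (hX.measure_ball_lt_top x₀ R' hR'0)).ne⟩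
    rw [hVempty, measure_empty] at this
    simpa using ENNReal.Tendsto.const_mul this (Or.inr hDt)
  refine le_antisymm (ge_of_tendsto' hlim fun m => ?_) zero_le
  have hp := h.zpow_pos (k + m)
  have hpk : δ ^ (k + (m : ℤ)) ≤ δ ^ k := h.zpow_le (by lia)
  have := hX.countable_index h hle hZ (k + m)
  -- Net points near the missed set: their balls of radius `δ ^ (k + m)` cover it, while the balls
  -- shrunk by `a` are disjoint and lie in `V m`.
  let S : Set (Z (k + m)) := {β | ∃ x ∈ Eᶜ ∩ quasiBall ρ x₀ R, ρ x β < δ ^ (k + (m : ℤ))}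
  calc μ (Eᶜ ∩ quasiBall ρ x₀ R)
      ≤ μ (⋃ β : S, quasiBall ρ β.1 (δ ^ (k + (m : ℤ)))) := by
        refine measure_mono fun x hx => ?_
        obtain ⟨β, hβ⟩ := (hZ (k + m)).exists_lt hρ hp x
        refine mem_iUnion.2 ⟨⟨β, x, hx, hβ⟩, ?_⟩
        show ρ β x < _
        rwa [hρ.symm]
    _ ≤ ∑' β : S, μ (quasiBall ρ β.1 (δ ^ (k + (m : ℤ)))) := measure_iUnion_le _
    _ ≤ ∑' β : S, D * μ (quasiBall ρ β.1 (a * δ ^ (k + (m : ℤ)))) := by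
        refine ENNReal.tsum_le_tsum fun β => hX.measure_quasiBall_le _ (by positivity) ?_
        have h1 : 1 ≤ 2 ^ n * a := ((div_lt_iff₀ ha).1 hn).le
        have := mul_le_mul_of_nonneg_right h1 hp.le
        linarith
    _ = D * μ (⋃ β : S, quasiBall ρ β.1 (a * δ ^ (k + (m : ℤ)))) := by
        rw [ENNReal.tsum_mul_left, measure_iUnion]
        · intro β β' hne
          refine Disjoint.mono (quasiBall_subset_dyadicCube (hle.refl _))
            (quasiBall_subset_dyadicCube (hle.refl _))
            (pairwise_disjoint_dyadicCube hle hρ h hZ (k + m) fun e => hne (Subtype.ext e))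
        · exact fun β => (hX.isOpen_ball _ _ (by positivity)).measurableSet
    _ ≤ D * μ (V m) := by
        gcongr
        refine iUnion_subset ?_
        rintro ⟨β, x, ⟨hxE, hxR⟩, hxβ⟩
        have hsub : quasiBall ρ β (a * δ ^ (k + (m : ℤ))) ⊆
            quasiBall ρ x (2 * A * δ ^ (k + (m : ℤ))) := by
          refine hρ.quasiBall_subset hA hxβ.le ?_
          have h1 : a ≤ 1 := by have := h.a_le_eighth; linarith
          have := mul_le_mul_of_nonneg_left h1 (show 0 ≤ A * δ ^ (k + (m : ℤ)) by positivity)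
          linarith
        refine subset_inter (hsub.trans (subset_iUnion₂_of_subset x hxE subset_rfl))
          (subset_inter ?_ (hsub.trans (hρ.quasiBall_subset hA (le_of_lt hxR) ?_)))
        · obtain ⟨α, hα⟩ := hle.exists_le (show k ≤ k + m by lia) β
          exact (quasiBall_subset_dyadicCube hα).trans (subset_iUnion _ α)
        · rw [hR']
          gcongr

/-- The measure of the part of a cube near its complement decays geometrically. -/
theorem measure_near_compl_le (hX : IsHomogeneousType ρ μ A A₁) (h : IsAdmissible A δ a)
    (hle : IsTreeOrder ρ A δ Z le) (hZ : ∀ k, IsMaximalSeparated ρ (δ ^ k) (Z k)) {q : ℝ≥0∞}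
    (hq : ∀ (k : ℤ) (α : Z k) (γ : Z (k + 1)), le ⟨k + 1, γ⟩ ⟨k, α⟩ →
      μ (dyadicCube ρ δ a le k α \ dyadicCube ρ δ a le (k + 1) γ) ≤
        q * μ (dyadicCube ρ δ a le k α)) {s : ℝ} (n : ℕ) :
    ∀ (k : ℤ) (α : Z k), s ≤ a / (2 * A) * δ ^ (k + (n : ℤ)) →
      μ {x ∈ dyadicCube ρ δ a le k α | ∃ y ∉ dyadicCube ρ δ a le k α, ρ x y < s} ≤
        q ^ n * μ (dyadicCube ρ δ a le k α) := by
  have hρ := hX.isQuasiMetric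
  have hA := h.one_le
  have ha := h.a_pos
  induction n with
  | zero =>
    intro k α _
    simpa using measure_mono (sep_subset _ _)
  | succ n ih =>
    intro k α hs
    obtain ⟨γ₀, hγ₀, hdeep⟩ := exists_central_child hle hρ h hZ α
    have := hX.countable_index h hle hZ (k + 1)
    let S : Set (Z (k + 1)) := {γ | le ⟨k + 1, γ⟩ ⟨k, α⟩ ∧ γ ≠ γ₀}
    let N : ∀ {l : ℤ}, Z l → Set X := fun {l} γ =>
      {x ∈ dyadicCube ρ δ a le l γ | ∃ y ∉ dyadicCube ρ δ a le l γ, ρ x y < s}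
    -- A point outside the parent is outside each child, so the same `y` and the same `s` serve in
    -- the child's layer.
    have hsub : N α ⊆
        (⋃ γ : S, N γ.1) ∪ (⋃ γ : Z (k + 1), dyadicCube ρ δ a le (k + 1) γ)ᶜ := by
      rintro x ⟨hx, y, hy, hxy⟩
      by_cases hxE : x ∈ ⋃ γ : Z (k + 1), dyadicCube ρ δ a le (k + 1) γ
      · obtain ⟨γ, hγ⟩ := mem_iUnion.1 hxE
        have hγα := le_of_dyadicCubes_meet hle hρ h hZ (by lia) hx hγ
        refine Or.inl (mem_iUnion.2 ⟨⟨γ, hγα, ?_⟩, hγ, y, fun hy' =>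
          hy (dyadicCube_subset hle hγα hy'), hxy⟩)
        rintro rfl
        refine hy (hdeep x hγ y (hxy.trans_le (hs.trans ?_)))
        have := h.zpow_le (show k ≤ k + ((n + 1 : ℕ) : ℤ) by lia)
        gcongr
      · exact Or.inr hxE
    calc μ (N α) ≤ μ (⋃ γ : S, N γ.1) + 0 :=
          (measure_mono hsub).trans ((measure_union_le _ _).trans_eq (by
            rw [hX.measure_compl_iUnion_dyadicCube h hle hZ (k + 1)]))
      _ ≤ ∑' γ : S, μ (N γ.1) := by
          rw [add_zero]
          exact measure_iUnion_le _
      _ ≤ ∑' γ : S, q ^ n * μ (dyadicCube ρ δ a le (k + 1) γ.1) :=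
          ENNReal.tsum_le_tsum fun γ => ih (k + 1) γ.1 (by
            rwa [show k + 1 + (n : ℤ) = k + ((n + 1 : ℕ) : ℤ) by push_cast; ring])
      _ = q ^ n * μ (⋃ γ : S, dyadicCube ρ δ a le (k + 1) γ.1) := by
          rw [ENNReal.tsum_mul_left, measure_iUnion]
          · exact fun γ γ' hne =>
              pairwise_disjoint_dyadicCube hle hρ h hZ (k + 1) fun e => hne (Subtype.ext e)
          · exact fun γ => hX.measurableSet_dyadicCube h γ.1
      _ ≤ q ^ n * μ (dyadicCube ρ δ a le k α \ dyadicCube ρ δ a le (k + 1) γ₀) := by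
          gcongr
          refine iUnion_subset fun γ => subset_sdiff.2 ⟨dyadicCube_subset hle γ.2.1, ?_⟩
          exact pairwise_disjoint_dyadicCube hle hρ h hZ (k + 1) γ.2.2
      _ ≤ q ^ n * (q * μ (dyadicCube ρ δ a le k α)) := by
          gcongr
          exact hq k α γ₀ hγ₀
      _ = q ^ (n + 1) * μ (dyadicCube ρ δ a le k α) := by ring

end IsHomogeneousType

/-- The factor `1 - 1 / D` would do, but vanishes for `D = 1`; halving `1 / D` keeps the ratio
positive, as its logarithm is needed later. -/
theorem MeasureTheory.Measure.measure_diff_le_of_le_mul {Ω : Type*} [MeasurableSpace Ω]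
    {μ : Measure Ω} {s t : Set Ω} (hts : t ⊆ s) (ht : MeasurableSet t) (hs : μ s ≠ ∞) {D : ℝ}
    (hD : 1 ≤ D) (h : μ s ≤ ENNReal.ofReal D * μ t) :
    μ (s \ t) ≤ ENNReal.ofReal (1 - 1 / (2 * D)) * μ s := by
  have htt : μ t ≠ ∞ := measure_ne_top_of_subset hts hs
  have h1 : 1 / (2 * D) ≤ 1 := by
    rw [div_le_one (by linarith)]
    linarith
  rw [measure_sdiff hts ht.nullMeasurableSet htt, ← ENNReal.ofReal_toReal hs,
    ← ENNReal.ofReal_toReal htt, ← ENNReal.ofReal_sub _ ENNReal.toReal_nonneg,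
    ← ENNReal.ofReal_mul (by linarith)]
  refine ENNReal.ofReal_le_ofReal ?_
  have h2 : (μ s).toReal ≤ D * (μ t).toReal := by
    have := ENNReal.toReal_mono (ENNReal.mul_ne_top ENNReal.ofReal_ne_top htt) h
    rwa [ENNReal.toReal_mul, ENNReal.toReal_ofReal (by linarith)] at this
  have h3 : (μ s).toReal / (2 * D) ≤ (μ t).toReal := by
    rw [div_le_iff₀ (by linarith)]
    have : 0 ≤ D * (μ t).toReal := by positivity
    linarith
  have h4 : 1 / (2 * D) * (μ s).toReal = (μ s).toReal / (2 * D) := by ring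
  linarith

/-- Choose `η` with `δ ^ η = q`, and `n` with `t / c` between `δ ^ (n + 1)` and `δ ^ n`. The
off-by-one costs the factor `q⁻¹` in `C`; for `t ≥ c` the first alternative holds. -/
theorem exists_pow_le_rpow {δ c q : ℝ} (hδ : 0 < δ) (hδ1 : δ < 1) (hc : 0 < c) (hq : 0 < q)
    (hq1 : q < 1) : ∃ η C : ℝ, 0 < η ∧ 0 < C ∧ ∀ t > 0, 1 ≤ C * t ^ η ∨
      ∃ n : ℕ, t ≤ c * δ ^ n ∧ q ^ n ≤ C * t ^ η := by
  have hη : 0 < Real.log q / Real.log δ :=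
    div_pos_of_neg_of_neg (Real.log_neg hq hq1) (Real.log_neg hδ hδ1)
  have hδη : δ ^ (Real.log q / Real.log δ) = q := by
    rw [Real.rpow_def_of_pos hδ, mul_div_cancel₀ _ (Real.log_neg hδ hδ1).ne, Real.exp_log hq]
  set η := Real.log q / Real.log δ
  refine ⟨η, q⁻¹ * (c⁻¹) ^ η, hη, by positivity, fun t ht => ?_⟩
  have hCt : q⁻¹ * (c⁻¹) ^ η * t ^ η = q⁻¹ * (t / c) ^ η := by
    rw [mul_assoc, ← Real.mul_rpow (by positivity) ht.le, div_eq_inv_mul]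
  rw [hCt]
  rcases le_total 1 (t / c) with h1 | h1
  · left
    exact one_le_mul_of_one_le_of_one_le (one_le_inv_iff₀.2 ⟨hq, hq1.le⟩)
      (Real.one_le_rpow h1 hη.le)
  · right
    obtain ⟨n, hn, hn'⟩ := exists_nat_pow_near_of_lt_one (div_pos ht hc) h1 hδ hδ1
    refine ⟨n, by rwa [div_le_iff₀' hc] at hn', ?_⟩
    have h2 : q ^ (n + 1) ≤ (t / c) ^ η := by
      rw [← hδη, ← Real.rpow_natCast, ← Real.rpow_mul hδ.le, mul_comm, Real.rpow_mul hδ.le,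
        Real.rpow_natCast]
      exact Real.rpow_le_rpow (by positivity) hn.le hη.le
    rw [le_inv_mul_iff₀ hq]
    linarith [pow_succ' q n]

end Measure

/-! ### Choice of constants and conclusion -/

theorem exists_isAdmissible {A : ℝ} (hA : 1 ≤ A) : ∃ δ a : ℝ, IsAdmissible A δ a := by
  have h0 : 0 < A := by linarith
  refine ⟨1 / (64 * A ^ 7), 1 / (8 * A ^ 3), hA, by positivity, by positivity, ?_, ?_⟩
  · exact le_of_eq (by field_simp)
  · exact le_of_eq (by field_simp; norm_num)

theorem exists_lt_of_quasiInfDist_lt {X : Type*} {ρ : X → X → ℝ} {x : X} {s : Set X} {r : ℝ}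
    (h : quasiInfDist ρ x s < ENNReal.ofReal r) : ∃ y ∈ s, ρ x y < r := by
  simp only [quasiInfDist, iInf_lt_iff] at h
  obtain ⟨y, hy, hlt⟩ := h
  exact ⟨y, hy, (ENNReal.ofReal_lt_ofReal_iff'.1 hlt).1⟩

theorem mainTheorem1 (A₀ A₁ : ℝ) (hA₀ : 1 ≤ A₀) (hA₁ : 1 ≤ A₁) :
    ∃ (δ a₀ η C₁ C₂ : ℝ) (N₀ : ℕ),
      0 < δ ∧ δ < 1 ∧ 0 < a₀ ∧ a₀ < 1 ∧ 0 < η ∧ 0 < C₁ ∧ 0 < C₂ ∧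
      ∀ (X : Type*) [TopologicalSpace X] [MeasurableSpace X] [BorelSpace X]
        (ρ : X → X → ℝ) (μ : MeasureTheory.Measure X), IsHomogeneousType ρ μ A₀ A₁ →
      ∀ Z : ℤ → Set X, (∀ k, IsMaximalSeparated ρ (δ ^ k) (Z k)) →
      ∀ le : IndexPair Z → IndexPair Z → Prop, IsTreeOrder ρ A₀ δ Z le →
        (∀ (k : ℤ) (α : Z k), IsOpen (dyadicCube ρ δ a₀ le k α)) ∧
        (∀ (k : ℤ) (α : Z k), quasiBall ρ α (a₀ * δ ^ k) ⊆ dyadicCube ρ δ a₀ le k α) ∧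
        (∀ (k : ℤ) (α : Z k),
          quasiDiam ρ (dyadicCube ρ δ a₀ le k α) ≤ ENNReal.ofReal (C₁ * δ ^ k)) ∧
        (∀ (k : ℤ) (α : Z k) (l : ℤ), l < k →
          ∃! β : Z l, dyadicCube ρ δ a₀ le k α ⊆ dyadicCube ρ δ a₀ le l β) ∧
        (∀ (k l : ℤ) (α : Z k) (β : Z l), k ≤ l →
          Xor (dyadicCube ρ δ a₀ le l β ⊆ dyadicCube ρ δ a₀ le k α)
            (dyadicCube ρ δ a₀ le l β ∩ dyadicCube ρ δ a₀ le k α = ∅)) ∧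
        (∀ (k : ℤ) (α : Z k),
          {Q ∈ dyadicFamily ρ δ a₀ le (k + 1) | Q ⊆ dyadicCube ρ δ a₀ le k α}.encard ≤ N₀) ∧
        (∀ k : ℤ, μ (⋃ α : Z k, dyadicCube ρ δ a₀ le k α)ᶜ = 0) ∧
        (∀ (k : ℤ) (α : Z k) (t : ℝ), 0 < t →
          μ {x ∈ dyadicCube ρ δ a₀ le k α |
              quasiInfDist ρ x (closure (dyadicCube ρ δ a₀ le k α))ᶜ ≤
                ENNReal.ofReal (t * δ ^ k)} ≤
            ENNReal.ofReal (C₂ * t ^ η) * μ (dyadicCube ρ δ a₀ le k α)) := by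
  obtain ⟨δ, a, h⟩ := exists_isAdmissible hA₀
  have ha := h.a_pos
  have hδ := h.δ_pos
  obtain ⟨n, hn⟩ := pow_unbounded_of_one_lt (4 * A₀ ^ 3 / (a * δ)) (one_lt_two (α := ℝ))
  have hn' : 4 * A₀ ^ 3 ≤ 2 ^ n * (a * δ) := ((div_lt_iff₀ (by positivity)).1 hn).le
  have hD : 1 ≤ A₁ ^ n := one_le_pow₀ hA₁
  have hDof : ENNReal.ofReal A₁ ^ n = ENNReal.ofReal (A₁ ^ n) :=
    (ENNReal.ofReal_pow (by linarith) n).symm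
  obtain ⟨N, hN⟩ := exists_nat_ge (A₁ ^ n)
  have hN' : ENNReal.ofReal A₁ ^ n ≤ N := by
    rw [hDof]
    exact ENNReal.ofReal_le_of_le_toReal (by simpa using hN)
  set q : ℝ := 1 - 1 / (2 * A₁ ^ n) with hq
  have hq0 : 0 < q := by
    have : 1 / (2 * A₁ ^ n) < 1 := by
      rw [div_lt_one (by linarith)]
      linarith
    linarith
  have hq1 : q < 1 := by
    have : 0 < 1 / (2 * A₁ ^ n) := by positivity
    linarith
  -- The final halving makes room for `2 * (t * δ ^ k)` below: an infimum at most `t * δ ^ k` need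
  -- not be attained, but some point lies within twice that.
  obtain ⟨η, C, hη, hC, hηC⟩ := exists_pow_le_rpow hδ h.δ_lt_one
    (show 0 < a / (2 * A₀) / 2 by positivity) hq0 hq1
  refine ⟨δ, a, η, 6 * A₀ ^ 3, C, N, hδ, h.δ_lt_one, ha, by linarith [h.a_le_eighth], hη,
    by positivity, hC, ?_⟩
  intro X _ _ _ ρ μ hX Z hZ le hle
  have hρ := hX.isQuasiMetric
  refine ⟨fun k α => hX.isOpen_dyadicCube h α,
    fun k α => quasiBall_subset_dyadicCube (hle.refl _),
    fun k α => quasiDiam_dyadicCube_le hle hρ h α,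
    fun k α l hlk => existsUnique_dyadicCube_subset hle hρ h hZ hlk.le α,
    fun k l α β hkl => xor_subset_disjoint_dyadicCube hle hρ h hZ hkl α β,
    fun k α => ?_,
    fun k => hX.measure_compl_iUnion_dyadicCube h hle hZ k,
    fun k α t ht => ?_⟩
  · refine le_trans (le_trans (encard_le_encard ?_) (encard_image_le (dyadicCube ρ δ a le (k + 1)) _))
      (hX.encard_children_le h hle hZ hn' hN' α)
    rintro _ ⟨⟨γ, rfl⟩, hγ⟩
    exact ⟨γ, (dyadicCube_subset_iff hle hρ h hZ (by lia)).1 hγ, rfl⟩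
  · have hp := h.zpow_pos k
    rcases hηC t ht with h1 | ⟨m, hm, hqm⟩
    · calc _ ≤ 1 * μ (dyadicCube ρ δ a le k α) := by
            rw [one_mul]
            exact measure_mono (sep_subset _ _)
        _ ≤ _ := by
            gcongr
            exact ENNReal.one_le_ofReal.2 h1
    · have hdecay := hX.measure_near_compl_le h hle hZ (q := ENNReal.ofReal q)
        (fun l β γ hγ => Measure.measure_diff_le_of_le_mul (dyadicCube_subset hle hγ)
          (hX.measurableSet_dyadicCube h γ) (hX.measure_dyadicCube_lt_top h hle β).ne hD
          (hDof ▸ hX.measure_dyadicCube_le_child h hle hn' hγ))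
        (s := 2 * (t * δ ^ k)) m k α (by
          rw [zpow_add₀ hδ.ne', zpow_natCast]
          have := mul_le_mul_of_nonneg_right hm hp.le
          linarith)
      refine (measure_mono ?_).trans (hdecay.trans ?_)
      -- Points off the closure are off the cube, so the layer in the claim is contained in the one
      -- already estimated.
      · rintro x ⟨hx, hxt⟩
        obtain ⟨y, hy, hxy⟩ := exists_lt_of_quasiInfDist_lt (hxt.trans_lt
          ((ENNReal.ofReal_lt_ofReal_iff (by positivity)).2
            (show t * δ ^ k < 2 * (t * δ ^ k) by linarith [mul_pos ht hp])))
        exact ⟨hx, y, fun hy' => hy (subset_closure hy'), hxy⟩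
      · rw [← ENNReal.ofReal_pow hq0.le]
        gcongr
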